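/- Let $\mathbb{R}^m,\mathbb{R}^n$ ($m,n\ge 0$) carry inner products $\langle\cdot,\cdot\rangle$, and let $\mathbb{R}^{m,n}=\mathbb{R}^m\oplus\mathbb{R}^n$ carry the form $x\circ x'=\langle x_1,x_1'\rangle-\langle x_2,x_2'\rangle$. Let $\Lambda\subset\mathbb{R}^{m,n}$ be an even integral Lorentzian lattice: $\Lambda=\bigoplus_{i=1}^{m+n}\mathbb{Z}\lambda_i$ with $\lambda_1,\dots,\lambda_{m+n}$ linearly independent over $\mathbb{R}$, $\lambda\circ\lambda'\in\mathbb{Z}$ and $\lambda\circ\lambda\in2\mathbb{Z}$ for all $\lambda,\lambda'\in\Lambda$. Write $\lambda=(\alpha^\lambda,\beta^\lambda)$, and let $\Lambda_0=\Lambda_1^0\oplus\Lambda_2^0$, where $\Lambda_1^0=\{(\alpha,0)\in\Lambda\}$ and $\Lambda_2^0=\{(0,\beta)\in\Lambda\}$. Let $\epsilon$ be the $\mathbb{Z}$-bilinear map on $\Lambda\times\Lambda$ with $\epsilon(\lambda_i,\lambda_j)=\lambda_i\circ\lambda_j$ for $i>j$ and $0$ for $i\le j$. Let $\mathfrak{h}_1=\mathbb{C}^m$,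 $\mathfrak{h}_2=\mathbb{C}^n$ with the $\mathbb{C}$-bilinear extensions of $\langle\cdot,\cdot\rangle$, let $\hat{\mathfrak{h}}^-=\bigoplus_{r<0}(\mathfrak{h}_1\otimes t^r)\oplus(\mathfrak{h}_2\otimes\bar t^{\,r})$, and write $\alpha(r)=\alpha\otimes t^r$, $\beta(r)=\beta\otimes\bar t^{\,r}$. For $[\mu]\in\Lambda/\Lambda_0$ put $$W_\mu=S(\hat{\mathfrak{h}}^-)\otimes\mathbb{C}[\mu+\Lambda_0],\qquad V_\Lambda=W_0=S(\hat{\mathfrak{h}}^-)\otimes\mathbb{C}[\Lambda_0].$$ On $W_\mu$, $\alpha(r)$ and $\beta(r)$ act by multiplication for $r<0$; $\alpha(0)e^\nu=\langle\alpha,\alpha^\nu\rangle e^\nu$ and $\beta(0)e^\nu=\langle\beta,\beta^\nu\rangle e^\nu$; for $r>0$ they annihilate every $e^\nu$; and $[\alpha(r),\alpha'(s)]=r\langle\alpha,\alpha'\rangle\delta_{r+s,0}$, $[\beta(r),\beta'(s)]=r\langle\beta,\beta'\rangle\delta_{r+s,0}$, $[\alpha(r),\beta(s)]=0$. For $\lambda\in\Lambda_0$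 let $e_\lambda(f\otimes e^\nu)=(-1)^{\epsilon(\lambda,\nu)}f\otimes e^{\lambda+\nu}$, $x^{\alpha^\lambda}(f\otimes e^\nu)=x^{\langle\alpha^\lambda,\alpha^\nu\rangle}f\otimes e^\nu$, $\bar x^{\beta^\lambda}(f\otimes e^\nu)=\bar x^{\langle\beta^\lambda,\beta^\nu\rangle}f\otimes e^\nu$, and $$Y_{W_\mu}(e^\lambda,x,\bar x)=\exp\Big(-\sum_{r<0}\tfrac{\alpha^\lambda(r)}{r}x^{-r}\Big)\exp\Big(-\sum_{r<0}\tfrac{\beta^\lambda(r)}{r}\bar x^{-r}\Big)\exp\Big(-\sum_{r>0}\tfrac{\alpha^\lambda(r)}{r}x^{-r}\Big)\exp\Big(-\sum_{r>0}\tfrac{\beta^\lambda(r)}{r}\bar x^{-r}\Big)e_\lambda\,x^{\alpha^\lambda}\bar x^{\beta^\lambda}.$$ With $\alpha(x)=\sum_{r\in\mathbb{Z}}\alpha(r)x^{-r-1}$ and $\beta(\bar x)=\sum_{r\in\mathbb{Z}}\beta(r)\bar x^{-r-1}$, define, for $v=\alpha_1(-m_1)\cdots\alpha_k(-m_k)\,\beta_1(-\bar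 m_1)\cdots\beta_{\bar k}(-\bar m_{\bar k})\otimes e^\lambda\in V_\Lambda$, $$Y_{W_\mu}(v,x,\bar x)={:}\prod_{r=1}^{k}\frac{1}{(m_r-1)!}\frac{d^{m_r-1}\alpha_r(x)}{dx^{m_r-1}}\ \prod_{s=1}^{\bar k}\frac{1}{(\bar m_s-1)!}\frac{d^{\bar m_s-1}\beta_s(\bar x)}{d\bar x^{\bar m_s-1}}\ Y_{W_\mu}(e^\lambda,x,\bar x){:}$$ where normal ordering puts the modes with negative index to the left of $Y_{W_\mu}(e^\lambda,x,\bar x)$ and those with non-negative index to its right; extend linearly to $v\in V_\Lambda$. Then for every $[\mu]\in\Lambda/\Lambda_0$ the $V_\Lambda$-module $(W_\mu,Y_{W_\mu})$ is irreducible: $W_\mu\ne0$, and if $U\subseteq W_\mu$ is a linear subspace such that all coefficients of $Y_{W_\mu}(u,x,\bar x)w$ lie in $U$ for all $u\in V_\Lambda$ and $w\in U$, then $U=0$ or $U=W_\mu$. -/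

import Mathlib

noncomputable section

/-! ### Lorentzian lattices -/

/-- The form `x ∘ y = ⟨x₁, y₁⟩ - ⟨x₂, y₂⟩` on `ℝ^{m,n} = ℝ^m ⊕ ℝ^n`, where `⟨·,·⟩` on `ℝ^m`, `ℝ^n`
has Gram matrix `B₁`, `B₂`. -/
def lorentzForm {m n : ℕ} (B₁ : Matrix (Fin m) (Fin m) ℝ) (B₂ : Matrix (Fin n) (Fin n) ℝ)
    (x y : Fin m ⊕ Fin n → ℝ) : ℝ :=
  (∑ i, ∑ j, x (.inl i) * B₁ i j * y (.inl j)) - ∑ i, ∑ j, x (.inr i) * B₂ i j * y (.inr j)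

/-- An even integral Lorentzian lattice of signature `(m, n)`: the `ℤ`-span of `m + n` linearly
independent vectors of `ℝ^{m,n}` (that is, of a real basis), which is integral and even for
`∘`. The bilinear forms on the Euclidean spaces `ℝ^m`, `ℝ^n` are arbitrary inner products. -/
structure EvenLorentzianLattice (m n : ℕ) where
  form₁ : Matrix (Fin m) (Fin m) ℝ
  form₂ : Matrix (Fin n) (Fin n) ℝ
  posDef₁ : form₁.PosDef
  posDef₂ : form₂.PosDef
  basis : Module.Basis (Fin (m + n)) ℝ (Fin m ⊕ Fin n → ℝ)
  integral : ∀ x ∈ Submodule.span ℤ (Set.range basis), ∀ y ∈ Submodule.span ℤ (Set.range basis),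
    ∃ k : ℤ, lorentzForm form₁ form₂ x y = k
  even : ∀ x ∈ Submodule.span ℤ (Set.range basis), ∃ k : ℤ, lorentzForm form₁ form₂ x x = 2 * k

/-! ### Formal series with operator coefficients -/

section Formal

variable {W : Type*} [AddCommGroup W] [Module ℂ W]

/-- The sum of a family of operators of which only finitely many are non-zero on each vector. -/
def lfSum {ι : Type*} (F : ι → Module.End ℂ W) (h : ∀ w, {i | F i w ≠ 0}.Finite) :
    Module.End ℂ W where
  toFun w := ∑ᶠ i, F i w
  map_add' v w := by
    simp only [map_add]
    exact finsum_add_distrib (h v) (h w)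
  map_smul' c w := by
    simp only [map_smul, RingHom.id_apply]
    exact (smul_finsum' c (h w)).symm

/-- The exponential `∑ₖ A^k / k!` of a power series without constant term (then the terms with
`k > N` do not contribute to the coefficient of order `N`). -/
def expSeries {R : Type*} [Ring R] [Algebra ℂ R] (A : PowerSeries R) : PowerSeries R :=
  PowerSeries.mk fun N => ∑ k ∈ Finset.range (N + 1),
    ((k.factorial : ℂ)⁻¹) • PowerSeries.coeff N (A ^ k)

variable (W) in
/-- A formal series `∑ F_{p,q} x^p x̄^q` with `F_{p,q} ∈ End W` and real exponents, such that for
each `w` the exponents of `x` and of `x̄` that occur in `F w` are bounded below. -/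
structure FormalField where
  coeff : ℝ × ℝ → Module.End ℂ W
  trunc : ∀ w, ∃ N : ℝ, ∀ p, coeff p w ≠ 0 → N ≤ p.1 ∧ N ≤ p.2

end Formal

/-! ### The Fock space -/

/-- The symmetric algebra `S(ĥ⁻)` of
`ĥ⁻ = ⨁_{r > 0} (h₁ ⊗ t^{-r}) ⊕ (h₂ ⊗ t̄^{-r})`, with `h₁ = ℂ^m` and `h₂ = ℂ^n`: the variable
`(i, r)` stands for `e_i(-(r + 1))`, where `e_i` is the standard basis vector of
`h₁ ⊕ h₂`. -/
abbrev Fock (m n : ℕ) : Type := MvPolynomial ((Fin m ⊕ Fin n) × ℕ) ℂ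

namespace EvenLorentzianLattice

variable {m n : ℕ} (L : EvenLorentzianLattice m n)

/-- The lattice `Λ`. -/
abbrev Λ : Submodule ℤ (Fin m ⊕ Fin n → ℝ) := Submodule.span ℤ (Set.range L.basis)

/-- `Λ₁⁰ = {(α, 0) ∈ Λ}`. -/
def Λ₁₀ : Submodule ℤ L.Λ where
  carrier := {l | ∀ j, l.1 (.inr j) = 0}
  add_mem' {a b} ha hb j := by simp [ha j, hb j]
  zero_mem' j := by simp
  smul_mem' c a ha j := by simp [ha j]

/-- `Λ₂⁰ = {(0, β) ∈ Λ}`. -/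
def Λ₂₀ : Submodule ℤ L.Λ where
  carrier := {l | ∀ i, l.1 (.inl i) = 0}
  add_mem' {a b} ha hb j := by simp [ha j, hb j]
  zero_mem' j := by simp
  smul_mem' c a ha j := by simp [ha j]

/-- `Λ₀ = Λ₁⁰ ⊕ Λ₂⁰`, an internal sum in `Λ`. -/
def Λ₀ : Submodule ℤ L.Λ := L.Λ₁₀ ⊔ L.Λ₂₀

/-- The `ℤ`-bilinear cocycle `ε` on `Λ` with `ε(λ_i, λ_j) = λ_i ∘ λ_j` for `i > j` and `0` for
`i ≤ j`, where `λ_i` is the integral basis. The floor is exact because `Λ` is integral. -/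
def ε (x y : L.Λ) : ℤ :=
  ∑ i, ∑ j, if j < i then
    (L.basis.restrictScalars ℤ).repr x i * (L.basis.restrictScalars ℤ).repr y j *
      ⌊lorentzForm L.form₁ L.form₂ (L.basis i) (L.basis j)⌋ else 0

/-- The Gram matrix of the sum of the two Euclidean forms on `h₁ ⊕ h₂`. -/
def gram : Matrix (Fin m ⊕ Fin n) (Fin m ⊕ Fin n) ℝ := Matrix.fromBlocks L.form₁ 0 0 L.form₂

/-- The `ℂ`-bilinear form on `h₁ ⊕ h₂` which is `⟨·,·⟩` on each summand. -/
def pairing (a b : Fin m ⊕ Fin n → ℂ) : ℂ := ∑ i, ∑ j, a i * (L.gram i j : ℂ) * b j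

/-- A lattice vector as an element of `h₁ ⊕ h₂`. -/
def toCartan (l : L.Λ) : Fin m ⊕ Fin n → ℂ := fun i => (l.1 i : ℂ)

/-- `α^λ ∈ h₁`, for `λ = (α^λ, β^λ)`. -/
def alpha (l : L.Λ) : Fin m ⊕ Fin n → ℂ := Sum.elim (fun i => (l.1 (.inl i) : ℂ)) 0

/-- `β^λ ∈ h₂`, for `λ = (α^λ, β^λ)`. -/
def beta (l : L.Λ) : Fin m ⊕ Fin n → ℂ := Sum.elim 0 (fun j => (l.1 (.inr j) : ℂ))

/-- The real numbers `(⟨α^λ, α^ν⟩, ⟨β^λ, β^ν⟩)`. -/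
def exponents (l v : L.Λ) : ℝ × ℝ :=
  (∑ i, ∑ j, l.1 (.inl i) * L.form₁ i j * v.1 (.inl j),
    ∑ i, ∑ j, l.1 (.inr i) * L.form₂ i j * v.1 (.inr j))

/-- The coset `c ∈ Λ/Λ₀`, as a subset of `Λ`. -/
abbrev Coset (c : L.Λ ⧸ L.Λ₀) : Type := {v : L.Λ // (Submodule.Quotient.mk v : L.Λ ⧸ L.Λ₀) = c}

/-- `V_Λ = S(ĥ⁻) ⊗ ℂ[Λ₀]`; `f ⊗ e^λ` is `Finsupp.single λ f`. -/
abbrev V : Type := L.Λ₀ →₀ Fock m n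

/-- `W_μ = S(ĥ⁻) ⊗ ℂ[μ + Λ₀]` for a coset `c = [μ]`; `f ⊗ e^ν` is `Finsupp.single ν f`. -/
abbrev W (c : L.Λ ⧸ L.Λ₀) : Type := L.Coset c →₀ Fock m n

variable (c : L.Λ ⧸ L.Λ₀)

/-- The operator on `W_μ` acting by `T ν` on `S(ĥ⁻) ⊗ e^ν`. -/
def diag (T : L.Coset c → Module.End ℂ (Fock m n)) : Module.End ℂ (L.W c) :=
  Finsupp.lsum ℂ fun v => Finsupp.lsingle v ∘ₗ T v

/-- The action of `a(k) = a ⊗ t^k` on `W_μ`, for `a ∈ h₁ ⊕ h₂` and `k ∈ ℤ`: for `k < 0` it is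
multiplication by `a(k)`; `a(0) e^ν = ⟨a, ν⟩ e^ν`; for `k > 0` it is the derivation of `S(ĥ⁻)` with
`a(k) · b(-s) = k ⟨a, b⟩ δ_{k,s}`, which kills each `e^ν`. The central elements act as `1`. -/
def mode (a : Fin m ⊕ Fin n → ℂ) : ℤ → Module.End ℂ (L.W c)
  | .negSucc r => L.diag c fun _ =>
      LinearMap.mulLeft ℂ (∑ i, MvPolynomial.C (a i) * MvPolynomial.X (i, r))
  | .ofNat 0 => L.diag c fun v => L.pairing a (L.toCartan v.1) • LinearMap.id
  | .ofNat (r + 1) => L.diag c fun _ => ((r + 1 : ℕ) : ℂ) •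
      ∑ i, (∑ j, a j * (L.gram j i : ℂ)) •
        (MvPolynomial.pderiv (i, r) : Derivation ℂ (Fock m n) (Fock m n)).toLinearMap

theorem add_mem_coset (l : L.Λ₀) (v : L.Coset c) :
    (Submodule.Quotient.mk (l.1 + v.1) : L.Λ ⧸ L.Λ₀) = c := by
  rw [Submodule.Quotient.mk_add, (Submodule.Quotient.mk_eq_zero _).2 l.2, zero_add, v.2]

/-- The operator `e_λ : f ⊗ e^ν ↦ (-1)^{ε(λ, ν)} f ⊗ e^{λ + ν}`. -/
def eOp (l : L.Λ₀) : Module.End ℂ (L.W c) :=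
  Finsupp.lsum ℂ fun v =>
    ((-1 : ℂ) ^ L.ε l.1 v.1) • Finsupp.lsingle ⟨l.1 + v.1, L.add_mem_coset c l v⟩

open Classical in
/-- The coefficient of `x^{p.1} x̄^{p.2}` in the operator
`x^{α^λ} x̄^{β^λ} : f ⊗ e^ν ↦ x^{⟨α^λ, α^ν⟩} x̄^{⟨β^λ, β^ν⟩} f ⊗ e^ν`. -/
def xPow (l : L.Λ₀) (p : ℝ × ℝ) : Module.End ℂ (L.W c) :=
  L.diag c fun v => if L.exponents l.1 v.1 = p then LinearMap.id else 0

/-- `exp(-∑_{r<0} (a(r)/r) x^{-r})`, a power series in `x` (the term `s = 0` below is zero). -/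
def creExp (a : Fin m ⊕ Fin n → ℂ) : PowerSeries (Module.End ℂ (L.W c)) :=
  expSeries (PowerSeries.mk fun s => ((s : ℂ)⁻¹) • L.mode c a (-(s : ℤ)))

/-- `exp(-∑_{r>0} (a(r)/r) x^{-r})`, a power series in `x⁻¹` (the term `s = 0` below is zero). -/
def annExp (a : Fin m ⊕ Fin n → ℂ) : PowerSeries (Module.End ℂ (L.W c)) :=
  expSeries (PowerSeries.mk fun s => (-(s : ℂ)⁻¹) • L.mode c a (s : ℤ))

/-! Local finiteness: `a(k)` lowers the degree on `S(ĥ⁻)` by `k`. -/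

/-- The degree `∑ (r + 1)` of a monomial `∏ e_i(-(r + 1))`. -/
def wt (d : (Fin m ⊕ Fin n) × ℕ →₀ ℕ) : ℕ := d.sum fun x k => k * (x.2 + 1)

/-- The vectors of `W_μ` of degree at most `N` in `S(ĥ⁻)`. -/
def degLE (N : ℤ) : Submodule ℂ (L.W c) where
  carrier := {w | ∀ v d, MvPolynomial.coeff d (w v) ≠ 0 → (wt d : ℤ) ≤ N}
  add_mem' {a b} ha hb v d h := by
    by_contra hN
    apply h
    have h1 : MvPolynomial.coeff d (a v) = 0 := by
      by_contra h'
      exact hN (ha v d h')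
    have h2 : MvPolynomial.coeff d (b v) = 0 := by
      by_contra h'
      exact hN (hb v d h')
    simp [h1, h2]
  zero_mem' v d h := by simp at h
  smul_mem' k a ha v d h := ha v d (by
    intro h'
    apply h
    simp [h'])

variable {L c}

theorem diag_apply (T : L.Coset c → Module.End ℂ (Fock m n)) (w : L.W c) (v : L.Coset c) :
    L.diag c T w v = T v (w v) := by
  classical
  simp only [diag, Finsupp.lsum_apply]
  rw [Finsupp.sum_apply, Finsupp.sum, Finset.sum_eq_single v]
  · simp
  · intro b _ hb
    simp [hb]
  · intro h
    rw [Finsupp.notMem_support_iff.1 h]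
    simp

theorem exists_mem_degLE (w : L.W c) : ∃ N : ℕ, w ∈ L.degLE c N := by
  classical
  refine ⟨w.support.sup fun v => (w v).support.sup wt, fun v d h => ?_⟩
  have hv : v ∈ w.support := by
    rw [Finsupp.mem_support_iff]
    intro h0
    simp [h0] at h
  have hd : d ∈ (w v).support := MvPolynomial.mem_support_iff.2 h
  exact_mod_cast (Finset.le_sup (f := wt) hd).trans
    (Finset.le_sup (f := fun v => (w v).support.sup wt) hv)

theorem eq_zero_of_mem_degLE {N : ℤ} (hN : N < 0) {w : L.W c} (h : w ∈ L.degLE c N) : w = 0 := by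
  refine Finsupp.ext fun v => MvPolynomial.ext _ _ fun d => ?_
  by_contra h'
  have h1 := h v d (by simpa using h')
  omega

theorem degLE_mono {M N : ℤ} (h : M ≤ N) : L.degLE c M ≤ L.degLE c N :=
  fun _ hw v d hd => (hw v d hd).trans h

theorem wt_add_single (d : (Fin m ⊕ Fin n) × ℕ →₀ ℕ) (x : (Fin m ⊕ Fin n) × ℕ) :
    wt (d + Finsupp.single x 1) = wt d + (x.2 + 1) := by
  classical
  unfold wt
  rw [Finsupp.sum_add_index' (by simp) (by intros; ring), Finsupp.sum_single_index (by simp)]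
  ring

theorem mode_mem_degLE (a : Fin m ⊕ Fin n → ℂ) (k : ℕ) (hk : k ≠ 0) {N : ℤ} {w : L.W c}
    (hw : w ∈ L.degLE c N) : L.mode c a (k : ℤ) w ∈ L.degLE c (N - k) := by
  obtain ⟨r, rfl⟩ := Nat.exists_eq_succ_of_ne_zero hk
  intro v d h
  change MvPolynomial.coeff d (L.diag c _ w v) ≠ 0 at h
  rw [diag_apply] at h
  simp only [LinearMap.smul_apply, LinearMap.sum_apply, MvPolynomial.coeff_smul,
    MvPolynomial.coeff_sum] at h
  obtain ⟨i, -, hi⟩ := Finset.exists_ne_zero_of_sum_ne_zero (right_ne_zero_of_smul h)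
  have h2 := right_ne_zero_of_smul hi
  change MvPolynomial.coeff d (MvPolynomial.pderiv (i, r) (w v)) ≠ 0 at h2
  rw [MvPolynomial.coeff_pderiv] at h2
  have h3 := hw v _ (left_ne_zero_of_mul h2)
  rw [wt_add_single] at h3
  push_cast at h3 ⊢
  linarith

/-- The coefficient of order `k` lowers the degree by `k`. -/
def Lowers (A : PowerSeries (Module.End ℂ (L.W c))) : Prop :=
  ∀ (k : ℕ) (N : ℤ) (w : L.W c), w ∈ L.degLE c N → PowerSeries.coeff k A w ∈ L.degLE c (N - k)

theorem Lowers.mul {A B : PowerSeries (Module.End ℂ (L.W c))} (hA : Lowers A) (hB : Lowers B) :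
    Lowers (A * B) := by
  intro k N w hw
  rw [PowerSeries.coeff_mul, LinearMap.sum_apply]
  refine Submodule.sum_mem _ fun x hx => ?_
  have hx' := Finset.HasAntidiagonal.mem_antidiagonal.1 hx
  have h1 := hA x.1 _ _ (hB x.2 _ _ hw)
  have h2 : N - (x.2 : ℤ) - x.1 = N - k := by
    rw [← hx']
    push_cast
    ring
  rw [h2] at h1
  exact h1

theorem Lowers.pow {A : PowerSeries (Module.End ℂ (L.W c))} (hA : Lowers A) (j : ℕ) :
    Lowers (A ^ j) := by
  induction j with
  | zero =>
    intro k N w hw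
    rw [pow_zero, PowerSeries.coeff_one]
    split_ifs with h
    · subst h
      simpa using hw
    · simp
  | succ j ih =>
    rw [pow_succ]
    exact ih.mul hA

theorem lowers_annExp (a : Fin m ⊕ Fin n → ℂ) : Lowers (L.annExp c a) := by
  intro k N w hw
  rw [annExp, expSeries, PowerSeries.coeff_mk, LinearMap.sum_apply]
  refine Submodule.sum_mem _ fun j _ => Submodule.smul_mem _ _ (Lowers.pow ?_ j k N w hw)
  intro s N w hw
  rw [PowerSeries.coeff_mk]
  by_cases hs : s = 0
  · simp [hs]
  · exact Submodule.smul_mem _ _ (mode_mem_degLE a s hs hw)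

theorem xPow_mem_degLE (l : L.Λ₀) (p : ℝ × ℝ) {N : ℤ} {w : L.W c} (hw : w ∈ L.degLE c N) :
    L.xPow c l p w ∈ L.degLE c N := by
  intro v d h
  rw [xPow, diag_apply] at h
  split_ifs at h
  · exact hw v d h
  · simp at h

theorem eOp_mem_degLE (l : L.Λ₀) {N : ℤ} {w : L.W c} (hw : w ∈ L.degLE c N) :
    L.eOp c l w ∈ L.degLE c N := by
  rw [eOp, Finsupp.lsum_apply]
  refine Submodule.sum_mem _ fun v _ => Submodule.smul_mem _ _ fun v' d h => hw v d ?_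
  classical
  rw [Finsupp.lsingle_apply, Finsupp.single_apply] at h
  split_ifs at h
  · exact h
  · simp at h

theorem exists_of_xPow_ne_zero (l : L.Λ₀) (p : ℝ × ℝ) (w : L.W c) (h : L.xPow c l p w ≠ 0) :
    p ∈ (fun v : L.Coset c => L.exponents l.1 v.1) '' (w.support : Set (L.Coset c)) := by
  obtain ⟨v, hv⟩ := Finsupp.ne_iff.1 h
  rw [xPow, diag_apply] at hv
  split_ifs at hv with h'
  · refine ⟨v, ?_, h'⟩
    simpa using hv
  · simp at hv

variable (L c)

/-- The contribution to the coefficient of `x^{p.1} x̄^{p.2}` in `Y(e^λ, x, x̄)` of the terms of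
order `k.1`, `k.2.1` (in `x`, `x̄`) of the exponentials of creation operators and `k.2.2.1`,
`k.2.2.2` (in `x⁻¹`, `x̄⁻¹`) of the exponentials of annihilation operators. -/
def expTerm (l : L.Λ₀) (p : ℝ × ℝ) (k : ℕ × ℕ × ℕ × ℕ) : Module.End ℂ (L.W c) :=
  PowerSeries.coeff k.1 (L.creExp c (L.alpha l.1)) *
    PowerSeries.coeff k.2.1 (L.creExp c (L.beta l.1)) *
    PowerSeries.coeff k.2.2.1 (L.annExp c (L.alpha l.1)) *
    PowerSeries.coeff k.2.2.2 (L.annExp c (L.beta l.1)) *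
    L.eOp c l * L.xPow c l (p.1 - k.1 + k.2.2.1, p.2 - k.2.1 + k.2.2.2)

theorem expTerm_bound (l : L.Λ₀) (w : L.W c) : ∃ (N : ℕ) (S : Set (ℝ × ℝ)), S.Finite ∧
    ∀ p k, L.expTerm c l p k w ≠ 0 → k.2.2.1 ≤ N ∧ k.2.2.2 ≤ N ∧
      (p.1 - k.1 + k.2.2.1, p.2 - k.2.1 + k.2.2.2) ∈ S := by
  obtain ⟨N, hN⟩ := exists_mem_degLE w
  refine ⟨N, _, w.support.finite_toSet.image fun v : L.Coset c => L.exponents l.1 v.1, ?_⟩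
  intro p k h
  simp only [expTerm, Module.End.mul_apply] at h
  have h1 := eOp_mem_degLE l
    (xPow_mem_degLE l (p.1 - k.1 + k.2.2.1, p.2 - k.2.1 + k.2.2.2) hN)
  have h2 := lowers_annExp (L.beta l.1) k.2.2.2 _ _ h1
  have h3 := lowers_annExp (L.alpha l.1) k.2.2.1 _ _ h2
  refine ⟨?_, ?_, exists_of_xPow_ne_zero l _ w fun h0 => h (by simp [h0])⟩
  · by_contra hk
    exact h (by rw [eq_zero_of_mem_degLE (by omega) h3]; simp)
  · by_contra hk
    exact h (by rw [eq_zero_of_mem_degLE (by omega) h3]; simp)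

theorem expTerm_finite (l : L.Λ₀) (p : ℝ × ℝ) (w : L.W c) :
    {k | L.expTerm c l p k w ≠ 0}.Finite := by
  obtain ⟨N, S, hS, h⟩ := L.expTerm_bound c l w
  have hf : ((Set.Iic N ×ˢ Set.Iic N) ×ˢ S).Finite :=
    ((Set.finite_Iic N).prod (Set.finite_Iic N)).prod hS
  refine Set.Finite.of_injOn (f := fun k : ℕ × ℕ × ℕ × ℕ => ((k.2.2.1, k.2.2.2),
    ((p.1 - k.1 + k.2.2.1, p.2 - k.2.1 + k.2.2.2) : ℝ × ℝ))) (t := _) ?_ ?_ hf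
  · intro k hk
    obtain ⟨h1, h2, h3⟩ := h p k hk
    exact ⟨⟨h1, h2⟩, h3⟩
  · rintro ⟨a, b, d, e⟩ - ⟨a', b', d', e'⟩ - hk
    simp only [Prod.mk.injEq] at hk ⊢
    obtain ⟨⟨rfl, rfl⟩, h1, h2⟩ := hk
    refine ⟨?_, ?_, rfl, rfl⟩
    · exact_mod_cast (by linarith : (a : ℝ) = a')
    · exact_mod_cast (by linarith : (b : ℝ) = b')

/-- The vertex operator of `e^λ` for `λ ∈ Λ₀`, acting on `W_μ`:
`exp(-∑_{r<0} (α^λ(r)/r) x^{-r}) exp(-∑_{r<0} (β^λ(r)/r) x̄^{-r})`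
`exp(-∑_{r>0} (α^λ(r)/r) x^{-r}) exp(-∑_{r>0} (β^λ(r)/r) x̄^{-r}) e_λ x^{α^λ} x̄^{β^λ}`. -/
def expField (l : L.Λ₀) : FormalField (L.W c) where
  coeff p := lfSum (L.expTerm c l p) (L.expTerm_finite c l p)
  trunc w := by
    obtain ⟨N, S, hS, h⟩ := L.expTerm_bound c l w
    obtain ⟨M₁, hM₁⟩ := (hS.image Prod.fst).bddBelow
    obtain ⟨M₂, hM₂⟩ := (hS.image Prod.snd).bddBelow
    refine ⟨min M₁ M₂ - N, fun p hp => ?_⟩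
    obtain ⟨k, hk⟩ : ∃ k, L.expTerm c l p k w ≠ 0 := by
      by_contra! h0
      exact hp (by simp [lfSum, h0])
    obtain ⟨h1, h2, h3⟩ := h p k hk
    have h4 := hM₁ (Set.mem_image_of_mem _ h3)
    have h5 := hM₂ (Set.mem_image_of_mem _ h3)
    have h6 := min_le_left M₁ M₂
    have h7 := min_le_right M₁ M₂
    have h8 : (k.2.2.1 : ℝ) ≤ N := by exact_mod_cast h1
    have h9 : (k.2.2.2 : ℝ) ≤ N := by exact_mod_cast h2
    have h10 : (0 : ℝ) ≤ k.1 := Nat.cast_nonneg _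
    have h11 : (0 : ℝ) ≤ k.2.1 := Nat.cast_nonneg _
    simp only at h4 h5
    constructor <;> linarith

/-- The direction of the variable of the fields `e_i(x)`, `i ≤ m`, and `e_j(x̄)`, `j ≤ n`. -/
def dir : Fin m ⊕ Fin n → ℝ × ℝ := Sum.elim (fun _ => (1, 0)) (fun _ => (0, 1))

/-- The `k`-th term in the coefficient at `p` of the normal ordered product of
`(1/r!) (d/dx)^r e_i(x) = ∑_k C(-k-1, r) e_i(k) x^{-k-1-r}` and `F`: the modes
with `k < 0` stand to the left of `F`, those with `k ≥ 0` to the right. -/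
def nordTerm (i : Fin m ⊕ Fin n) (r : ℕ) (F : FormalField (L.W c)) (p : ℝ × ℝ) (k : ℤ) :
    Module.End ℂ (L.W c) :=
  ((Ring.choose (-k - 1) r : ℤ) : ℂ) •
    if k < 0 then L.mode c (Pi.single i 1) k * F.coeff (p + ((k + 1 + r : ℤ) : ℝ) • dir i)
    else F.coeff (p + ((k + 1 + r : ℤ) : ℝ) • dir i) * L.mode c (Pi.single i 1) k

theorem nordTerm_bound (i : Fin m ⊕ Fin n) (r : ℕ) (F : FormalField (L.W c)) (w : L.W c) :
    ∃ (M : ℝ) (K : ℕ), ∀ p k, L.nordTerm c i r F p k w ≠ 0 → k ≤ K ∧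
      M ≤ (p + ((k + 1 + r : ℤ) : ℝ) • dir i).1 ∧ M ≤ (p + ((k + 1 + r : ℤ) : ℝ) • dir i).2 := by
  obtain ⟨K, hK⟩ := exists_mem_degLE w
  obtain ⟨M₀, hM₀⟩ := F.trunc w
  choose B hB using fun k : ℤ => F.trunc (L.mode c (Pi.single i 1) k w)
  obtain ⟨M₁, hM₁⟩ := ((Set.finite_Icc (0 : ℤ) K).image B).bddBelow
  refine ⟨min M₀ M₁, K, fun p k h => ?_⟩
  have h' := right_ne_zero_of_smul (by simpa only [nordTerm, LinearMap.smul_apply] using h)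
  split_ifs at h' with hk
  · have h1 := hM₀ (p + ((k + 1 + r : ℤ) : ℝ) • dir i) fun h0 => h' (by
      rw [Module.End.mul_apply, h0, map_zero])
    exact ⟨by omega, (min_le_left _ _).trans h1.1, (min_le_left _ _).trans h1.2⟩
  · have hkK : k ≤ K := by
      by_contra hlt
      obtain ⟨j, rfl⟩ := Int.eq_ofNat_of_zero_le (not_lt.1 hk)
      have h2 := mode_mem_degLE (Pi.single i 1) j (by omega) hK
      exact h' (by rw [Module.End.mul_apply, eq_zero_of_mem_degLE (by omega) h2, map_zero])
    have h1 := hB k (p + ((k + 1 + r : ℤ) : ℝ) • dir i) h'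
    have h2 := hM₁ (Set.mem_image_of_mem B ⟨not_lt.1 hk, hkK⟩)
    exact ⟨hkK, (min_le_right _ _).trans (h2.trans h1.1), (min_le_right _ _).trans (h2.trans h1.2)⟩

theorem nordTerm_finite (i : Fin m ⊕ Fin n) (r : ℕ) (F : FormalField (L.W c)) (p : ℝ × ℝ)
    (w : L.W c) : {k | L.nordTerm c i r F p k w ≠ 0}.Finite := by
  obtain ⟨M, K, h⟩ := L.nordTerm_bound c i r F w
  refine (Set.finite_Icc (⌊min (M - p.1) (M - p.2)⌋ - 1 - r) (K : ℤ)).subset fun k hk => ?_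
  obtain ⟨h1, h2, h3⟩ := h p k hk
  refine ⟨?_, h1⟩
  have h4 := Int.floor_le (min (M - p.1) (M - p.2))
  have h5 : ((⌊min (M - p.1) (M - p.2)⌋ : ℤ) : ℝ) ≤ ((k + 1 + r : ℤ) : ℝ) := by
    rcases i with i | i
    · simp only [dir, Sum.elim_inl, Prod.fst_add, Prod.smul_fst, smul_eq_mul, mul_one] at h2
      linarith [min_le_left (M - p.1) (M - p.2)]
    · simp only [dir, Sum.elim_inr, Prod.snd_add, Prod.smul_snd, smul_eq_mul, mul_one] at h3
      linarith [min_le_right (M - p.1) (M - p.2)]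
  have h6 : ⌊min (M - p.1) (M - p.2)⌋ ≤ k + 1 + r := by exact_mod_cast h5
  linarith

/-- The normal ordered product of `(1/r!) (d/dx)^r e_i(x)` (with `x̄` in place of `x` if
`e_i ∈ h₂`) and `F`. -/
def nord (i : Fin m ⊕ Fin n) (r : ℕ) (F : FormalField (L.W c)) : FormalField (L.W c) where
  coeff p := lfSum (L.nordTerm c i r F p) (L.nordTerm_finite c i r F p)
  trunc w := by
    obtain ⟨M, K, h⟩ := L.nordTerm_bound c i r F w
    refine ⟨M - (K + 1 + r), fun p hp => ?_⟩
    obtain ⟨k, hk⟩ : ∃ k, L.nordTerm c i r F p k w ≠ 0 := by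
      by_contra! h0
      exact hp (by simp [lfSum, h0])
    obtain ⟨h1, h2, h3⟩ := h p k hk
    have h4 : (k : ℝ) ≤ K := by exact_mod_cast h1
    have h5 : (0 : ℝ) ≤ K := Nat.cast_nonneg _
    have h6 : (0 : ℝ) ≤ r := Nat.cast_nonneg _
    rcases i with i | i <;>
      simp [dir] at h2 h3 <;> constructor <;> linarith

/-- The vertex operator of `e_{i₁}(-r₁-1) ⋯ e_{iₖ}(-rₖ-1) ⊗ e^λ`, where `d` is the multiset of
the `(i_s, r_s)`: the normal ordered product of the fields `(1/r_s!) (d/dx)^{r_s} e_{i_s}(x)` and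
`Y(e^λ, x, x̄)`. Creation operators commute with each other, and so do the remaining modes;
hence the order in which the factors are listed is immaterial. -/
def monomialField (l : L.Λ₀) (d : (Fin m ⊕ Fin n) × ℕ →₀ ℕ) : FormalField (L.W c) :=
  (Finsupp.toMultiset d).toList.foldr (fun x F => L.nord c x.1 x.2 F) (L.expField c l)

/-- The module vertex operator map `Y_{W_μ} : V_Λ ⊗ W_μ → W_μ{x, x̄}`, extended linearly from the
monomial basis of `V_Λ`; `Y u w p` is the coefficient of `x^{p.1} x̄^{p.2}` in
`Y_{W_μ}(u, x, x̄) w`. -/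
def Y : L.V →ₗ[ℂ] L.W c →ₗ[ℂ] (ℝ × ℝ → L.W c) :=
  Finsupp.lsum ℂ fun l => (MvPolynomial.basisMonomials _ ℂ).constr ℂ fun d =>
    LinearMap.pi (L.monomialField c l d).coeff

end EvenLorentzianLattice

/-! ### Submodules and irreducibility -/

section Irreducible

variable {V W : Type*} [AddCommGroup V] [Module ℂ V] [AddCommGroup W] [Module ℂ W]

/-- A subspace `U` of a module `(W, Y)` to which the vertex operator map restricts:
`Y(u, x, x̄) w ∈ U{x, x̄}` for all `u ∈ V` and `w ∈ U`. No further condition on `U` is imposed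
(such as being graded and satisfying the module axioms with the restricted map), so that the
absence of such subspaces is the strongest form of irreducibility. -/
def IsVertexSubmodule (Y : V →ₗ[ℂ] W →ₗ[ℂ] (ℝ × ℝ → W)) (U : Submodule ℂ W) : Prop :=
  ∀ u, ∀ w ∈ U, ∀ p, Y u w p ∈ U

/-- `(W, Y)` is non-zero and has no non-zero proper submodules. -/
def IsIrreducibleVertexModule (Y : V →ₗ[ℂ] W →ₗ[ℂ] (ℝ × ℝ → W)) : Prop :=
  Nontrivial W ∧ ∀ U : Submodule ℂ W, IsVertexSubmodule Y U → U = ⊥ ∨ U = ⊤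

end Irreducible

end

open EvenLorentzianLattice

/-! The vertex operators contain enough elementary operators to move any nonzero vector to any
other. Since `Y(1, x, x̄)` is the identity, `Y(e_i(-1), x, x̄)` is the current of `e_i`, so a vertex
submodule `U` is stable under every mode `e_i(k)` (`mode_mem_of_isVertexSubmodule`).

Three kinds of modes then do three jobs. Zero modes act on `S(ĥ⁻) ⊗ e^ν` by scalars that determine
`ν`, because the Gram matrix is invertible; hence a nonzero `U` contains some nonzero `f ⊗ e^ν`
(`exists_single_mem_of_isVertexSubmodule`). Positive modes give all partial derivatives, again by
inverting the Gram matrix, and these reduce `f` to a nonzero constant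
(`MvPolynomial.one_mem_of_pderiv_mem`). Negative modes multiply by the variables and rebuild all of
`S(ĥ⁻)` from `1`.

To pass between lattice points of one coset, note that the leading coefficient of `Y(e^λ, x, x̄)
e^ν` is `± e^{λ+ν}` (`expField_coeff_single_one`); so `U` contains every `e^ν` in the coset, and is
everything. -/

theorem coeff_zero_expSeries {R : Type*} [Ring R] [Algebra ℂ R] (A : PowerSeries R) :
    PowerSeries.coeff 0 (expSeries A) = 1 := by
  simp [expSeries]

theorem expSeries_zero {R : Type*} [Ring R] [Algebra ℂ R] :
    expSeries (0 : PowerSeries R) = 1 := by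
  ext N
  rw [expSeries, PowerSeries.coeff_mk, Finset.sum_eq_single 0]
  · simp
  · intro k _ hk
    simp [zero_pow hk]
  · simp

/-! ### Subspaces of polynomial rings stable under derivations or multiplications. -/

/-- A nonzero space of polynomials closed under all partial derivatives contains `1`. -/
theorem MvPolynomial.one_mem_of_pderiv_mem {σ K : Type*} [Field K] [CharZero K]
    (P : Submodule K (MvPolynomial σ K)) (hP : ∀ i, ∀ f ∈ P, pderiv i f ∈ P)
    {f : MvPolynomial σ K} (hf : f ∈ P) (h0 : f ≠ 0) : (1 : MvPolynomial σ K) ∈ P := by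
  classical
  -- Induction on a strict bound for the total degree; strictness makes the base case vacuous.
  have key : ∀ (N : ℕ) (f : MvPolynomial σ K), f ∈ P → f ≠ 0 →
      (∀ d, coeff d f ≠ 0 → d.degree < N) → (1 : MvPolynomial σ K) ∈ P := by
    intro N
    induction N with
    | zero =>
      intro f _ h0 hd
      obtain ⟨d, hd'⟩ := ne_zero_iff.1 h0
      exact absurd (hd d hd') (Nat.not_lt_zero _)
    | succ N ih =>
      intro f hf h0 hd
      by_cases h : ∃ i, pderiv i f ≠ 0
      · obtain ⟨i, hi⟩ := h
        refine ih _ (hP i f hf) hi fun d h' => ?_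
        rw [coeff_pderiv] at h'
        have := hd _ (left_ne_zero_of_mul h')
        rw [map_add, Finsupp.degree_single] at this
        omega
      · push Not at h
        have hc : f = C (coeff 0 f) := by
          ext d
          rw [coeff_C]
          split_ifs with hd0
          · rw [hd0]
          · obtain ⟨i, hi⟩ := Finsupp.ne_iff.1 (Ne.symm hd0)
            have hle : Finsupp.single i 1 ≤ d := by
              rw [Finsupp.single_le_iff]
              exact Nat.one_le_iff_ne_zero.2 hi
            -- The coefficient of `f` at `d`, multiplied by the positive integer `d i`, is a
            -- coefficient of a vanishing derivative; characteristic zero allows cancelling `d i`.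
            have h1 := coeff_pderiv (i := i) f (d - Finsupp.single i 1)
            rw [h i, coeff_zero, tsub_add_cancel_of_le hle] at h1
            exact (mul_eq_zero.1 h1.symm).resolve_right (Nat.cast_add_one_ne_zero _)
        have hc0 : coeff 0 f ≠ 0 := fun h' => h0 (by rw [hc, h', C_0])
        have h1 : (1 : MvPolynomial σ K) = (coeff 0 f)⁻¹ • f := by
          conv_rhs => rw [hc]
          rw [smul_eq_C_mul, coeff_C, if_pos rfl, ← C_mul, inv_mul_cancel₀ hc0, C_1]
        rw [h1]
        exact P.smul_mem _ hf
  refine key (f.support.sup Finsupp.degree + 1) f hf h0 fun d hd => Nat.lt_succ_of_le ?_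
  exact Finset.le_sup (f := Finsupp.degree) (mem_support_iff.2 hd)

/-- A space of polynomials containing `1` and closed under multiplication by the variables is
everything. -/
theorem MvPolynomial.mem_of_X_mul_mem {σ K : Type*} [CommSemiring K]
    (P : Submodule K (MvPolynomial σ K)) (hP : ∀ i, ∀ f ∈ P, X i * f ∈ P)
    (h1 : (1 : MvPolynomial σ K) ∈ P) (f : MvPolynomial σ K) : f ∈ P := by
  induction f using MvPolynomial.induction_on with
  | C a => simpa [smul_eq_C_mul] using P.smul_mem a h1
  | add p q hp hq => exact P.add_mem hp hq
  | mul_X p i hp => rw [mul_comm]; exact hP i p hp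

namespace EvenLorentzianLattice

/-! ### Nondegeneracy of the form on `h₁ ⊕ h₂`. -/

variable {m n : ℕ} (L : EvenLorentzianLattice m n) (c : L.Λ ⧸ L.Λ₀)

/-- The determinant is the product of those of two positive definite blocks. The sum of the two
Euclidean forms enters here, not their Lorentzian difference. -/
theorem isUnit_det_gram : IsUnit L.gram.det := by
  rw [gram, Matrix.det_fromBlocks_zero₂₁]
  exact (L.posDef₁.det_pos.ne'.isUnit).mul L.posDef₂.det_pos.ne'.isUnit

theorem pairing_single (i : Fin m ⊕ Fin n) (b : Fin m ⊕ Fin n → ℂ) :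
    L.pairing (Pi.single i 1) b = ∑ j, (L.gram i j : ℂ) * b j := by
  rw [pairing, Finset.sum_eq_single i]
  · simp
  · intro k _ hk
    simp [hk]
  · simp

/-- The zero modes separate lattice vectors. -/
theorem eq_of_pairing_eq (u v : L.Λ)
    (h : ∀ i, L.pairing (Pi.single i 1) (L.toCartan u) = L.pairing (Pi.single i 1) (L.toCartan v)) :
    u = v := by
  have h1 : L.gram.mulVec u.1 = L.gram.mulVec v.1 := by
    ext i
    have := h i
    simp only [pairing_single, toCartan] at this
    simp only [Matrix.mulVec, dotProduct]
    exact_mod_cast this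
  exact Subtype.ext (Matrix.mulVec_injective_of_isUnit
    ((Matrix.isUnit_iff_isUnit_det _).2 L.isUnit_det_gram) h1)

/-! ### Vertex operators of the vacuum and of `e_i(-1)`. -/

theorem diag_single (T : L.Coset c → Module.End ℂ (Fock m n)) (v : L.Coset c) (f : Fock m n) :
    L.diag c T (Finsupp.single v f) = Finsupp.single v (T v f) := by
  simp [diag]

theorem mode_zero (k : ℤ) : L.mode c 0 k = 0 := by
  refine LinearMap.ext fun w => Finsupp.ext fun v => ?_
  match k with
  | .negSucc r => simp [mode, diag_apply]
  | .ofNat 0 => simp [mode, diag_apply, pairing]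
  | .ofNat (r + 1) => simp [mode, diag_apply]

theorem creExp_zero : L.creExp c 0 = 1 := by
  refine Eq.trans (congrArg expSeries (PowerSeries.ext fun s => ?_)) expSeries_zero
  simp [mode_zero]

theorem annExp_zero : L.annExp c 0 = 1 := by
  refine Eq.trans (congrArg expSeries (PowerSeries.ext fun s => ?_)) expSeries_zero
  simp [mode_zero]

theorem coeff_zero_creExp (a : Fin m ⊕ Fin n → ℂ) :
    PowerSeries.coeff 0 (L.creExp c a) = 1 := coeff_zero_expSeries _

theorem coeff_zero_annExp (a : Fin m ⊕ Fin n → ℂ) :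
    PowerSeries.coeff 0 (L.annExp c a) = 1 := coeff_zero_expSeries _

theorem alpha_zero : L.alpha 0 = 0 := by
  ext i; rcases i with i | i <;> simp [alpha]

theorem beta_zero : L.beta 0 = 0 := by
  ext i; rcases i with i | i <;> simp [beta]

theorem eOp_single (l : L.Λ₀) (v : L.Coset c) (f : Fock m n) :
    L.eOp c l (Finsupp.single v f) = ((-1 : ℂ) ^ L.ε l.1 v.1) •
      Finsupp.single ⟨l.1 + v.1, L.add_mem_coset c l v⟩ f := by
  simp [eOp]

theorem eOp_zero : L.eOp c 0 = 1 := by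
  refine Finsupp.lhom_ext fun v f => ?_
  rw [eOp_single]
  have : L.ε (0 : L.Λ₀).1 v.1 = 0 := by simp [ε]
  rw [this]
  simp

theorem xPow_zero (p : ℝ × ℝ) : L.xPow c 0 p = if p = 0 then 1 else 0 := by
  refine Finsupp.lhom_ext fun v f => ?_
  have : L.exponents (0 : L.Λ₀).1 v.1 = 0 := by simp [exponents]
  rw [xPow, diag_single, this]
  by_cases hp : p = 0
  · simp [hp]
  · simp [hp, Ne.symm hp]

/-- `Y(1, x, x̄)` is the identity. -/
theorem expField_zero_coeff (p : ℝ × ℝ) :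
    (L.expField c 0).coeff p = if p = 0 then 1 else 0 := by
  refine LinearMap.ext fun w => ?_
  change ∑ᶠ k, L.expTerm c 0 p k w = _
  -- For `λ = 0` all four exponentials equal `1`, so only their terms of order zero survive.
  have h : ∀ k : ℕ × ℕ × ℕ × ℕ, k ≠ 0 → L.expTerm c 0 p k = 0 := by
    rintro ⟨k1, k2, k3, k4⟩ hk
    have hk' : k1 ≠ 0 ∨ k2 ≠ 0 ∨ k3 ≠ 0 ∨ k4 ≠ 0 := by
      by_contra! h
      obtain ⟨rfl, rfl, rfl, rfl⟩ := h
      exact hk rfl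
    simp only [expTerm, ZeroMemClass.coe_zero, alpha_zero, beta_zero, creExp_zero, annExp_zero,
      PowerSeries.coeff_one]
    rcases hk' with h | h | h | h <;> simp [h]
  rw [finsum_eq_single _ 0 fun k hk => by rw [h k hk]; rfl]
  simp [expTerm, alpha_zero, beta_zero, creExp_zero, annExp_zero, eOp_zero, xPow_zero]

theorem dir_ne_zero (i : Fin m ⊕ Fin n) : dir i ≠ 0 := by
  rcases i with i | i <;> simp [dir]

/-- The modes `e_i(k)` are the coefficients of `Y(e_i(-1), x, x̄)`. -/
theorem nord_expField_zero_coeff (i : Fin m ⊕ Fin n) (k : ℤ) :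
    (L.nord c i 0 (L.expField c 0)).coeff (-(((k + 1 : ℤ) : ℝ) • dir i)) =
      L.mode c (Pi.single i 1) k := by
  refine LinearMap.ext fun w => ?_
  change ∑ᶠ j, L.nordTerm c i 0 (L.expField c 0) _ j w = _
  -- As `Y(1, x, x̄)` has only the exponent `0`, the `j`-th normal ordered term contributes only
  -- when its residual exponent vanishes, which happens exactly for `j = k`, on either side of the
  -- normal ordering.
  have hp : ∀ j : ℤ, -(((k + 1 : ℤ) : ℝ) • dir i) + ((j + 1 + (0 : ℕ) : ℤ) : ℝ) • dir i = 0 ↔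
      j = k := by
    intro j
    rw [← neg_smul, ← add_smul, smul_eq_zero, or_iff_left (dir_ne_zero i)]
    push_cast
    constructor
    · intro h
      exact_mod_cast (by linarith : (j : ℝ) = k)
    · rintro rfl
      ring
  rw [finsum_eq_single _ k]
  · simp only [nordTerm, expField_zero_coeff, (hp k).2 rfl, if_true]
    simp
  · intro j hj
    simp only [nordTerm, expField_zero_coeff, if_neg (mt (hp j).1 hj)]
    simp

theorem Y_monomial (l : L.Λ₀) (d : (Fin m ⊕ Fin n) × ℕ →₀ ℕ) (w : L.W c) (p : ℝ × ℝ) :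
    L.Y c (Finsupp.single l (MvPolynomial.monomial d 1)) w p =
      (L.monomialField c l d).coeff p w := by
  have h := (MvPolynomial.basisMonomials ((Fin m ⊕ Fin n) × ℕ) ℂ).constr_basis ℂ
    (fun d => LinearMap.pi (L.monomialField c l d).coeff) d
  rw [MvPolynomial.coe_basisMonomials] at h
  rw [Y, Finsupp.lsum_single, h]
  rfl

/-! ### The leading coefficient of `Y(e^λ, x, x̄)` on `e^ν`. -/

theorem single_one_mem_degLE (v : L.Coset c) :
    (Finsupp.single v 1 : L.W c) ∈ L.degLE c 0 := by
  classical
  intro v' d h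
  rw [Finsupp.single_apply] at h
  split_ifs at h
  · rw [MvPolynomial.coeff_one] at h
    split_ifs at h with hd
    · simp [← hd, wt]
    · simp at h
  · simp at h

/-- The leading coefficient of `Y(e^λ, x, x̄) e^ν`. -/
theorem expField_coeff_single_one (l : L.Λ₀) (v : L.Coset c) :
    (L.expField c l).coeff (L.exponents l.1 v.1) (Finsupp.single v 1) =
      ((-1 : ℂ) ^ L.ε l.1 v.1) • Finsupp.single ⟨l.1 + v.1, L.add_mem_coset c l v⟩ 1 := by
  change ∑ᶠ k, L.expTerm c l _ k _ = _
  have hx : ∀ p, L.xPow c l p (Finsupp.single v 1) =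
      if L.exponents l.1 v.1 = p then Finsupp.single v 1 else 0 := by
    intro p
    rw [xPow, diag_single]
    split_ifs <;> simp
  have hmem : L.eOp c l (Finsupp.single v 1) ∈ L.degLE c 0 :=
    eOp_mem_degLE l (L.single_one_mem_degLE c v)
  rw [finsum_eq_single _ (0 : ℕ × ℕ × ℕ × ℕ)]
  · simp only [expTerm, Module.End.mul_apply, Prod.fst_zero, Prod.snd_zero, Nat.cast_zero,
      sub_zero, add_zero, coeff_zero_creExp, coeff_zero_annExp, Module.End.one_apply, hx, if_true,
      eOp_single, Prod.mk.eta]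
  · rintro ⟨k1, k2, k3, k4⟩ hk
    by_contra hne
    apply hne
    simp only [expTerm, Module.End.mul_apply, hx]
    split_ifs with hp
    · have h1 := congrArg Prod.fst hp
      have h2 := congrArg Prod.snd hp
      simp only at h1 h2
      have hb := lowers_annExp (L.beta l.1) k4 _ _ hmem
      have ha := lowers_annExp (L.alpha l.1) k3 _ _ hb
      -- The exponent condition `hp` says `k1 = k3` and `k2 = k4`. If no annihilation term occurs,
      -- then no creation term does either, contradicting `k ≠ 0`; otherwise the annihilation terms
      -- push a vector of degree at most `0` into negative degree.
      by_cases h34 : k3 = 0 ∧ k4 = 0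
      · obtain ⟨rfl, rfl⟩ := h34
        refine absurd ?_ hk
        have e1 : k1 = 0 := by
          have : (k1 : ℝ) = 0 := by push_cast at h1; linarith
          exact_mod_cast this
        have e2 : k2 = 0 := by
          have : (k2 : ℝ) = 0 := by push_cast at h2; linarith
          exact_mod_cast this
        rw [e1, e2]
        rfl
      · rw [eq_zero_of_mem_degLE (by omega) ha]
        simp
    · simp

/-! ### Vertex submodules and irreducibility. -/

section Submodule

variable {L c} {U : Submodule ℂ (L.W c)}

theorem mode_mem_of_isVertexSubmodule (hU : IsVertexSubmodule (L.Y c) U)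
    (i : Fin m ⊕ Fin n) (k : ℤ) {w : L.W c} (hw : w ∈ U) :
    L.mode c (Pi.single i 1) k w ∈ U := by
  -- The vector is `e_i(-1) ⊗ e^0`: the variable `(i, 0)` stands for the mode of index `-1`.
  have h := hU (Finsupp.single 0 (MvPolynomial.monomial (Finsupp.single (i, 0) 1) 1)) w hw
    (-(((k + 1 : ℤ) : ℝ) • dir i))
  have h1 : L.monomialField c 0 (Finsupp.single (i, 0) 1) = L.nord c i 0 (L.expField c 0) := by
    simp [monomialField]
  rwa [Y_monomial, h1, nord_expField_zero_coeff] at h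

theorem X_mul_mem_of_isVertexSubmodule (hU : IsVertexSubmodule (L.Y c) U)
    (v : L.Coset c) (x : (Fin m ⊕ Fin n) × ℕ) {f : Fock m n}
    (hf : Finsupp.single v f ∈ U) : Finsupp.single v (MvPolynomial.X x * f) ∈ U := by
  have h := mode_mem_of_isVertexSubmodule hU x.1 (.negSucc x.2) hf
  rw [mode, diag_single, LinearMap.mulLeft_apply, Finset.sum_eq_single x.1] at h
  · simpa using h
  · intro j _ hj
    simp [hj]
  · simp

/-- The standard basis need not be orthonormal, so `e_j(r + 1)` acts as a Gram combination of the
derivatives in the variables `(k, r)`. Applying the inverse Gram matrix isolates each derivative. -/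
theorem pderiv_mem_of_isVertexSubmodule (hU : IsVertexSubmodule (L.Y c) U)
    (v : L.Coset c) (x : (Fin m ⊕ Fin n) × ℕ) {f : Fock m n}
    (hf : Finsupp.single v f ∈ U) : Finsupp.single v (MvPolynomial.pderiv x f) ∈ U := by
  obtain ⟨i, r⟩ := x
  have h : ∀ j, Finsupp.single v (∑ k, (L.gram j k : ℂ) • MvPolynomial.pderiv (k, r) f) ∈ U := by
    intro j
    have h := mode_mem_of_isVertexSubmodule hU j (.ofNat (r + 1)) hf
    have hs : ∀ k, ∑ l, (Pi.single j 1 : Fin m ⊕ Fin n → ℂ) l * (L.gram l k : ℂ) =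
        (L.gram j k : ℂ) := by
      intro k
      rw [Finset.sum_eq_single j]
      · simp
      · intro l _ hl
        simp [hl]
      · simp
    rw [mode, diag_single, LinearMap.smul_apply, ← Finsupp.smul_single] at h
    have h0 : ((r + 1 : ℕ) : ℂ) ≠ 0 := by exact_mod_cast Nat.succ_ne_zero r
    have h' := (U.smul_mem_iff h0).1 h
    simp only [LinearMap.sum_apply, LinearMap.smul_apply, hs] at h'
    exact h'
  have hinv : ∀ k, ∑ j, (L.gram⁻¹ i j : ℂ) * (L.gram j k : ℂ) = if i = k then 1 else 0 := by
    intro k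
    have := congrFun (congrFun (Matrix.nonsing_inv_mul _ L.isUnit_det_gram) i) k
    rw [Matrix.mul_apply, Matrix.one_apply] at this
    split_ifs at this ⊢ <;> exact_mod_cast this
  have hsum : MvPolynomial.pderiv (i, r) f =
      ∑ j, (L.gram⁻¹ i j : ℂ) • ∑ k, (L.gram j k : ℂ) • MvPolynomial.pderiv (k, r) f := by
    simp only [Finset.smul_sum, smul_smul]
    rw [Finset.sum_comm]
    simp only [← Finset.sum_smul, hinv]
    simp
  rw [hsum, Finsupp.single_finsetSum]
  refine U.sum_mem fun j _ => ?_
  rw [← Finsupp.smul_single]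
  exact U.smul_mem _ (h j)

/-- Separation of eigenvectors: zero modes act diagonally with jointly distinct eigenvalues, so a
nonzero vector of minimal support in `U` lives over a single lattice point. -/
theorem exists_single_mem_of_isVertexSubmodule (hU : IsVertexSubmodule (L.Y c) U)
    {w : L.W c} (hw : w ∈ U) (h0 : w ≠ 0) :
    ∃ (v : L.Coset c) (f : Fock m n), f ≠ 0 ∧ Finsupp.single v f ∈ U := by
  classical
  induction hN : w.support.card using Nat.strong_induction_on generalizing w with
  | _ N ih =>
    obtain ⟨v, hv⟩ := Finsupp.support_nonempty_iff.2 h0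
    by_cases h : ∃ v' ∈ w.support, v' ≠ v
    · obtain ⟨v', hv', hne⟩ := h
      obtain ⟨i, hi⟩ : ∃ i, L.pairing (Pi.single i 1) (L.toCartan v'.1) ≠
          L.pairing (Pi.single i 1) (L.toCartan v.1) := by
        by_contra! h
        exact hne (Subtype.ext (L.eq_of_pairing_eq _ _ h))
      -- Subtracting the eigenvalue at `v` kills the component there, while the component at `v'` is
      -- only rescaled by a nonzero factor; the support shrinks without becoming empty.
      set w' := L.mode c (Pi.single i 1) 0 w -
        L.pairing (Pi.single i 1) (L.toCartan v.1) • w with hw'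
      have hval : ∀ u, w' u = (L.pairing (Pi.single i 1) (L.toCartan u.1) -
          L.pairing (Pi.single i 1) (L.toCartan v.1)) • w u := by
        intro u
        change L.diag c _ w u - _ = _
        rw [diag_apply, sub_smul]
        rfl
      have hmem : w' ∈ U :=
        U.sub_mem (mode_mem_of_isVertexSubmodule hU i 0 hw) (U.smul_mem _ hw)
      have hne' : w' ≠ 0 := by
        intro h
        have h1 := hval v'
        rw [h, Finsupp.zero_apply] at h1
        rcases smul_eq_zero.1 h1.symm with h2 | h2
        · exact hi (sub_eq_zero.1 h2)
        · exact Finsupp.mem_support_iff.1 hv' h2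
      have hlt : w'.support ⊂ w.support := by
        refine Finset.ssubset_iff_of_subset (fun u hu => ?_) |>.2 ⟨v, hv, ?_⟩
        · rw [Finsupp.mem_support_iff, hval] at hu
          exact Finsupp.mem_support_iff.2 (right_ne_zero_of_smul hu)
        · simp [hval]
      exact ih _ (hN ▸ Finset.card_lt_card hlt) hmem hne' rfl
    · push Not at h
      have hs : w = Finsupp.single v (w v) := by
        ext1 u
        rw [Finsupp.single_apply]
        split_ifs with hu
        · rw [hu]
        · by_contra h'
          exact hu (h u (Finsupp.mem_support_iff.2 h')).symm
      exact ⟨v, w v, Finsupp.mem_support_iff.1 hv, hs ▸ hw⟩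

/-- Two points of one coset differ by some `λ ∈ Λ₀`, so the leading coefficient of `Y(e^λ, x, x̄)`
carries one exponential to the other, up to a sign. -/
theorem single_one_mem_of_isVertexSubmodule (hU : IsVertexSubmodule (L.Y c) U)
    {v : L.Coset c} (hv : Finsupp.single v 1 ∈ U)
    (v' : L.Coset c) : Finsupp.single v' 1 ∈ U := by
  have hl : v'.1 - v.1 ∈ L.Λ₀ := (Submodule.Quotient.eq _).1 (v'.2.trans v.2.symm)
  have h := hU (Finsupp.single ⟨_, hl⟩ (MvPolynomial.monomial 0 1)) _ hv
    (L.exponents (v'.1 - v.1) v.1)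
  rw [Y_monomial] at h
  have h1 : L.monomialField c ⟨_, hl⟩ 0 = L.expField c ⟨_, hl⟩ := by simp [monomialField]
  rw [h1, L.expField_coeff_single_one c ⟨_, hl⟩ v,
    U.smul_mem_iff (zpow_ne_zero _ (neg_ne_zero.2 one_ne_zero))] at h
  simpa using h

theorem eq_bot_or_eq_top_of_isVertexSubmodule (hU : IsVertexSubmodule (L.Y c) U) :
    U = ⊥ ∨ U = ⊤ := by
  refine or_iff_not_imp_left.2 fun hbot => ?_
  obtain ⟨w, hw, h0⟩ := U.ne_bot_iff.1 hbot
  obtain ⟨v, f, hf0, hf⟩ := exists_single_mem_of_isVertexSubmodule hU hw h0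
  have h1 : Finsupp.single v 1 ∈ U :=
    -- The polynomials `g` with `g ⊗ e^v ∈ U` form a derivation-stable subspace containing `f ≠ 0`.
    MvPolynomial.one_mem_of_pderiv_mem (U.comap (Finsupp.lsingle v))
      (fun x _ hg => pderiv_mem_of_isVertexSubmodule hU v x hg) hf hf0
  refine U.eq_top_iff'.2 fun w => ?_
  induction w using Finsupp.induction_linear with
  | zero => exact U.zero_mem
  | add a b ha hb => exact U.add_mem ha hb
  | single v' g =>
    exact MvPolynomial.mem_of_X_mul_mem (U.comap (Finsupp.lsingle v'))
      (fun x _ hg => X_mul_mem_of_isVertexSubmodule hU v' x hg)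
      (single_one_mem_of_isVertexSubmodule hU h1 v') g

end Submodule

end EvenLorentzianLattice

theorem mainTheorem3 {m n : ℕ} (L : EvenLorentzianLattice m n) (c : L.Λ ⧸ L.Λ₀) :
    IsIrreducibleVertexModule (L.Y c) := by
  obtain ⟨v, hv⟩ := Submodule.Quotient.mk_surjective _ c
  have : Nonempty (L.Coset c) := ⟨⟨v, hv⟩⟩
  exact ⟨inferInstance, fun _ hU => eq_bot_or_eq_top_of_isVertexSubmodule hU⟩
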